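/- Let $d\ge 1$. Consider Bernoulli bond percolation on $\mathbb{Z}^d$: the nearest-neighbour edges are open independently with probability $p\in[0,1]$. Write $\mu$ for its law, $H(\omega)$ for the graph with vertex set $\mathbb{Z}^d$ and the open edges, and $\mathcal{C}_o$ for the connected component of $H(\omega)$ containing the origin $o$. Assume that the percolation is subcritical, $p<p_c$, where $p_c=\inf\{q : \mu_q(|\mathcal{C}_o|=\infty)>0\}$; then $\mathcal{C}_o$ is $\mu$-almost surely finite. Let $L=D-\mathcal{A}$ be the combinatorial Laplacian of $H(\omega)$ on $\ell^2(\mathbb{Z}^d)$, i.e. $(Lf)(x)=\sum_{y}(f(x)-f(y))$, the sum being over the open neighbours $y$ of $x$, let $e_o$ be the unit vector at the origin, and let $$N_N(E)=\mathbb{E}_\mu\big(e_o,\mathbb{1}_{[0,\infty)}(E-L)\,e_o\big),\qquad E\in\mathbb{R},$$ be the integrated density of states. Let $\widehat X_t$ be the continuous-time regularised random walk on $\mathcal{C}_o$: with $\delta=2d$ and $A=\delta^{-1}(\mathcal{A}+\delta\mathbb{I}-D)$, where $\mathcal{A}$ and $D$ are the adjacency and degree matrices of $\mathcal{C}_o$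 (so $A$ is the transition matrix of the simple random walk on the graph obtained from $\mathcal{C}_o$ by adding $\delta-\deg(x)$ loops at each vertex $x$, each loop counting one towards the degree), $$\mathbb{P}^x[\widehat X_t=y]=\sum_{n\ge0}e^{-t}\frac{t^n}{n!}(A^n)_{xy}.$$ Then $N_N$ is nondecreasing and right-continuous, all the expectations below exist, and for every $t\ge0$ $$\int_{(0,\infty)}e^{-tE}\,dN_N(E)=\mathbb{E}_\mu\,\mathbb{P}^o[\widehat X_{2dt}=o]-\mathbb{E}_\mu\Big[\frac1{|\mathcal{C}_o|}\Big],$$ where the integral is the Lebesgue–Stieltjes integral over the open half-line (the jump of $N_N$ at $E=0$ is not counted). -/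

import Mathlib

open MeasureTheory ProbabilityTheory

noncomputable section

namespace PercolationIDS

/-! ### Bernoulli bond percolation on the Euclidean lattice -/

/-- The nearest-neighbour graph on `ℤ^d`: two sites are adjacent iff they differ by a
unit coordinate vector. -/
def lattice (d : ℕ) : SimpleGraph (Fin d → ℤ) where
  Adj x y := ∃ i : Fin d, y = x + Pi.single i 1 ∨ x = y + Pi.single i 1
  symm := ⟨fun _ _ ⟨i, h⟩ => ⟨i, h.symm⟩⟩
  loopless := ⟨by
    rintro x ⟨i, h | h⟩ <;> simpa using congrFun h i⟩

/-- Bond configurations: every edge is open (`true`) or closed (`false`).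
It carries the product `σ`-algebra. -/
abbrev Config (d : ℕ) : Type := (lattice d).edgeSet → Bool

/-- The law of Bernoulli bond percolation: the edges are independent and each is open with
probability `p`. -/
def percMeasure (d : ℕ) (p : unitInterval) : Measure (Config d) :=
  Measure.infinitePi fun _ : (lattice d).edgeSet => bernoulliMeasure true false p

/-- The random partial graph `H(ω)` of `ℤ^d`: all sites, and the open edges. -/
def openGraph {d : ℕ} (ω : Config d) : SimpleGraph (Fin d → ℤ) :=
  SimpleGraph.fromEdgeSet {e | ∃ h : e ∈ (lattice d).edgeSet, ω ⟨e, h⟩ = true}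

/-- The open cluster `C_o` of the origin. -/
def originCluster {d : ℕ} (ω : Config d) : (openGraph ω).ConnectedComponent :=
  (openGraph ω).connectedComponentMk 0

/-- The origin, as a vertex of its cluster. -/
def originInCluster {d : ℕ} (ω : Config d) : originCluster ω :=
  ⟨0, SimpleGraph.ConnectedComponent.connectedComponentMk_mem⟩

/-- The critical probability `p_c = inf {q ∈ [0,1] : P_q(|C_o| = ∞) > 0}`. -/
def criticalProbability (d : ℕ) : unitInterval :=
  sInf {q | 0 < percMeasure d q {ω | (originCluster ω).supp.Infinite}}

/-! ### The regularised random walk -/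

section RegularisedWalk

variable {V : Type*} (H : SimpleGraph V) (δ : ℕ)

open scoped Classical in
/-- Adjacency matrix of the regularisation of `H`: at each vertex `x` one adds `δ - deg x` loops,
each of which increases the degree by one. -/
def regularisedAdj (x y : V) : ℝ :=
  (if H.Adj x y then 1 else 0) + (if x = y then (δ : ℝ) - (H.neighborSet x).ncard else 0)

/-- Transition matrix of the regularised random walk, the simple random walk on the
regularisation of `H` (in which all degrees are `δ`). -/
def rrwTransition (x y : V) : ℝ := regularisedAdj H δ x y / δ

open scoped Classical in
/-- `n`-step transition probabilities of the regularised random walk in discrete time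
(the entries of the `n`-th power of its transition matrix). -/
def rrwStep : ℕ → V → V → ℝ
  | 0, x, y => if x = y then 1 else 0
  | n + 1, x, y => ∑' z, rrwTransition H δ x z * rrwStep n z y

/-- Transition probabilities of the regularised random walk in continuous time: the number of
steps performed in `[0,t]` is Poisson distributed with mean `t`. -/
def rrwHeat (t : ℝ) (x y : V) : ℝ :=
  ∑' n : ℕ, Real.exp (-t) * t ^ n / (n.factorial : ℝ) * rrwStep H δ n x y

end RegularisedWalk

/-- The return probability `P^o[X̂_t = o]` of the continuous time regularised random walk on the
cluster of the origin; the walk is regularised to the degree `2d` of the lattice. -/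
def returnProb {d : ℕ} (t : ℝ) (ω : Config d) : ℝ :=
  rrwHeat (originCluster ω).toSimpleGraph (2 * d) t (originInCluster ω) (originInCluster ω)

/-! ### The graph Laplacian on `ℓ²(ℤ^d)` -/

/-- The Hilbert space `ℓ²(V)`. -/
abbrev EllTwo (V : Type*) : Type _ := lp (fun _ : V => ℂ) 2

open scoped Classical in
/-- The bounded operator `(T f) x = 1_S(x) f (φ x)` on `ℓ²(V)`, for a bijection `φ` of `V`. -/
def cutShift {V : Type*} (φ : V ≃ V) (S : Set V) : EllTwo V →L[ℂ] EllTwo V :=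
  have key : ∀ f : EllTwo V,
      Summable (fun x => ‖(if x ∈ S then f (φ x) else 0 : ℂ)‖ ^ (2 : ENNReal).toReal) ∧
      ∑' x, ‖(if x ∈ S then f (φ x) else 0 : ℂ)‖ ^ (2 : ENNReal).toReal
        ≤ ‖f‖ ^ (2 : ENNReal).toReal := by
    intro f
    have h0 : Summable (fun x => ‖f x‖ ^ (2 : ENNReal).toReal) :=
      (lp.memℓp f).summable (by norm_num)
    have h1 : Summable (fun x => ‖f (φ x)‖ ^ (2 : ENNReal).toReal) :=
      h0.comp_injective φ.injective
    have hle : ∀ x, ‖(if x ∈ S then f (φ x) else 0 : ℂ)‖ ^ (2 : ENNReal).toReal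
        ≤ ‖f (φ x)‖ ^ (2 : ENNReal).toReal := by
      intro x
      split_ifs
      · exact le_rfl
      · simp
    have h2 := Summable.of_nonneg_of_le (fun x => by positivity) hle h1
    refine ⟨h2, ?_⟩
    rw [lp.norm_rpow_eq_tsum (by norm_num) f,
      ← φ.tsum_eq (fun x => ‖f x‖ ^ (2 : ENNReal).toReal)]
    exact h2.tsum_le_tsum hle h1
  LinearMap.mkContinuous
    { toFun := fun f => ⟨fun x => if x ∈ S then f (φ x) else 0, memℓp_gen (key f).1⟩
      map_add' := by
        intro f g
        apply lp.ext
        funext x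
        change (if x ∈ S then f (φ x) + g (φ x) else 0 : ℂ) =
          (if x ∈ S then f (φ x) else 0) + (if x ∈ S then g (φ x) else 0)
        split_ifs <;> simp
      map_smul' := by
        intro c f
        apply lp.ext
        funext x
        by_cases h : x ∈ S <;> simp [h] }
    1 (by
      intro f
      rw [one_mul]
      exact lp.norm_le_of_tsum_le (by norm_num) (norm_nonneg f) (key f).2)

open scoped Classical in
theorem cutShift_apply {V : Type*} (φ : V ≃ V) (S : Set V) (f : EllTwo V) (x : V) :
    cutShift φ S f x = if x ∈ S then f (φ x) else 0 := rfl

/-- The unit coordinate vectors `± e_i` of `ℤ^d`. -/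
def unitStep {d : ℕ} (j : Fin d × Bool) : Fin d → ℤ :=
  Pi.single j.1 (if j.2 then 1 else -1)

/-- The combinatorial Laplacian `L = D - 𝒜` of the percolation graph as a bounded operator on
`ℓ²(ℤ^d)`, that is, `(L f) x = ∑ (f x - f y)` over the open neighbours `y` of `x`
(see `laplacian_apply`). -/
def laplacian {d : ℕ} (ω : Config d) : EllTwo (Fin d → ℤ) →L[ℂ] EllTwo (Fin d → ℤ) :=
  ∑ j : Fin d × Bool,
    (cutShift (Equiv.refl _) {x | (openGraph ω).Adj x (x + unitStep j)} -
      cutShift (Equiv.addRight (unitStep j)) {x | (openGraph ω).Adj x (x + unitStep j)})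

theorem openGraph_le {d : ℕ} (ω : Config d) : openGraph ω ≤ lattice d := by
  intro x y h
  rw [openGraph, SimpleGraph.fromEdgeSet_adj] at h
  obtain ⟨⟨h, -⟩, -⟩ := h
  simpa using h

theorem unitStep_injective {d : ℕ} : Function.Injective (unitStep (d := d)) := by
  rintro ⟨i, b⟩ ⟨k, c⟩ h
  have h1 := congrFun h i
  have hik : i = k := by
    by_contra hne
    cases b <;> cases c <;> simp [unitStep, hne] at h1
  subst hik
  cases b <;> cases c <;> simp [unitStep] at h1 ⊢

theorem lattice_adj_iff {d : ℕ} (x y : Fin d → ℤ) :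
    (lattice d).Adj x y ↔ ∃ j, y = x + unitStep j := by
  constructor
  · rintro ⟨i, h | h⟩
    · exact ⟨(i, true), by simpa [unitStep] using h⟩
    · refine ⟨(i, false), ?_⟩
      rw [h, unitStep]
      simp [Pi.single_neg]
  · rintro ⟨⟨i, b⟩, rfl⟩
    cases b
    · exact ⟨i, Or.inr (by simp [unitStep, Pi.single_neg])⟩
    · exact ⟨i, Or.inl (by simp [unitStep])⟩

theorem laplacian_apply {d : ℕ} (ω : Config d) (f : EllTwo (Fin d → ℤ)) (x : Fin d → ℤ) :
    laplacian ω f x = ∑ᶠ y ∈ (openGraph ω).neighborSet x, (f x - f y) := by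
  classical
  have hset : (openGraph ω).neighborSet x =
      ↑((Finset.univ.filter fun j : Fin d × Bool =>
        (openGraph ω).Adj x (x + unitStep j)).image fun j => x + unitStep j) := by
    ext y
    simp only [SimpleGraph.mem_neighborSet, Finset.coe_image, Finset.coe_filter,
      Finset.mem_univ, true_and, Set.mem_image, Set.mem_ofPred_eq]
    constructor
    · intro h
      obtain ⟨j, rfl⟩ := (lattice_adj_iff x y).1 (openGraph_le ω h)
      exact ⟨j, h, rfl⟩
    · rintro ⟨j, h, rfl⟩
      exact h
  rw [hset, finsum_mem_coe_finset, Finset.sum_image, Finset.sum_filter]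
  · have : ∀ s : Finset (Fin d × Bool), (∑ j ∈ s,
        (cutShift (Equiv.refl _) {x | (openGraph ω).Adj x (x + unitStep j)} -
        cutShift (Equiv.addRight (unitStep j)) {x | (openGraph ω).Adj x (x + unitStep j)})) f x =
        ∑ j ∈ s, if (openGraph ω).Adj x (x + unitStep j) then f x - f (x + unitStep j) else 0 := by
      intro s
      induction s using Finset.induction_on with
      | empty => simp
      | insert a s ha ih =>
        rw [Finset.sum_insert ha, Finset.sum_insert ha, ← ih]
        simp only [add_apply, sub_apply, lp.coeFn_add,
          lp.coeFn_sub, Pi.add_apply, Pi.sub_apply, cutShift_apply, Set.mem_ofPred_eq]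
        split_ifs <;> simp
    exact this Finset.univ
  · intro a _ b _ h
    exact unitStep_injective (add_left_cancel h)

theorem laplacian_isSelfAdjoint {d : ℕ} (ω : Config d) : IsSelfAdjoint (laplacian ω) := by
  classical
  set S : Fin d × Bool → Set (Fin d → ℤ) := fun j => {x | (openGraph ω).Adj x (x + unitStep j)}
    with hS
  have hneg : ∀ j : Fin d × Bool, unitStep (j.1, !j.2) = -unitStep j := by
    rintro ⟨i, b⟩
    cases b <;> simp [unitStep, Pi.single_neg]
  have h1 : ∀ (j : Fin d × Bool) (f g : EllTwo (Fin d → ℤ)),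
      inner ℂ (cutShift (Equiv.refl _) (S j) f) g =
        inner ℂ f (cutShift (Equiv.refl _) (S j) g) := by
    intro j f g
    rw [lp.inner_eq_tsum, lp.inner_eq_tsum]
    congr 1
    funext x
    rw [cutShift_apply, cutShift_apply]
    by_cases h : x ∈ S j <;> simp [h]
  have h2 : ∀ (j : Fin d × Bool) (f g : EllTwo (Fin d → ℤ)),
      inner ℂ (cutShift (Equiv.addRight (unitStep j)) (S j) f) g =
        inner ℂ f (cutShift (Equiv.addRight (unitStep (j.1, !j.2))) (S (j.1, !j.2)) g) := by
    intro j f g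
    rw [lp.inner_eq_tsum, lp.inner_eq_tsum, ← (Equiv.addRight (unitStep j)).tsum_eq
      (fun x => inner ℂ (f x)
        (cutShift (Equiv.addRight (unitStep (j.1, !j.2))) (S (j.1, !j.2)) g x))]
    congr 1
    funext x
    have hx : x ∈ S j ↔ x + unitStep j ∈ S (j.1, !j.2) := by
      simp only [hS, Set.mem_ofPred_eq, hneg, add_neg_cancel_right]
      exact (openGraph ω).adj_comm _ _
    rw [cutShift_apply, cutShift_apply]
    by_cases h : x ∈ S j
    · have h' := hx.1 h
      simp [h, h', hneg]
    · have h' := fun h'' => h (hx.2 h'')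
      rw [if_neg h, Equiv.coe_addRight, if_neg h']
      simp
  rw [ContinuousLinearMap.isSelfAdjoint_iff_isSymmetric]
  intro f g
  have hsplit : ∀ f : EllTwo (Fin d → ℤ), laplacian ω f =
      ∑ j, cutShift (Equiv.refl _) (S j) f -
        ∑ j, cutShift (Equiv.addRight (unitStep j)) (S j) f := by
    intro f
    simp [laplacian, hS, sum_apply, Finset.sum_sub_distrib]
  have hinv : Function.Involutive fun j : Fin d × Bool => (j.1, !j.2) := by
    rintro ⟨i, b⟩
    simp
  change inner ℂ (laplacian ω f) g = inner ℂ f (laplacian ω g)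
  rw [hsplit f, hsplit g, inner_sub_left, inner_sub_right, sum_inner, sum_inner, inner_sum,
    inner_sum, Finset.sum_congr rfl fun j _ => h1 j f g, Finset.sum_congr rfl fun j _ => h2 j f g,
    ← Equiv.sum_comp hinv.toPerm (fun j =>
      inner ℂ f (cutShift (Equiv.addRight (unitStep j)) (S j) g))]
  rfl

/-! ### Spectral projections and the integrated density of states -/

/-- The spectral projection `1_{(-∞,E]}(T) = 1_{[0,∞)}(E - T)` of a bounded self-adjoint operator,
that is, the orthogonal projection onto the kernel of the positive part `(T - E)⁺`. -/
def spectralProjection {𝓗 : Type*} [NormedAddCommGroup 𝓗] [InnerProductSpace ℂ 𝓗]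
    [CompleteSpace 𝓗] (T : 𝓗 →L[ℂ] 𝓗) (E : ℝ) : 𝓗 →L[ℂ] 𝓗 :=
  (cfc (fun x : ℝ => max (x - E) 0) T : 𝓗 →L[ℂ] 𝓗).ker.starProjection

/-- The unit vector `e_o` at the origin. -/
def originVector (d : ℕ) : EllTwo (Fin d → ℤ) :=
  lp.single 2 (0 : Fin d → ℤ) (1 : ℂ)

/-- The cumulative spectral function `(e_o, 1_{[0,∞)}(E - L) e_o)` at the origin. -/
def localSpectralFn {d : ℕ} (E : ℝ) (ω : Config d) : ℝ :=
  (inner ℂ (originVector d) (spectralProjection (laplacian ω) E (originVector d))).re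

/-- The integrated density of states `N_N(E) = 𝔼 (e_o, 1_{[0,∞)}(E - L) e_o)`. -/
def ids (d : ℕ) (p : unitInterval) (E : ℝ) : ℝ :=
  ∫ ω, localSpectralFn E ω ∂(percMeasure d p)

end PercolationIDS

end

/-! The formula comes from one measure. Let `originSpectralMeasure ω` be the spectral measure of `L`
at `e_o`. Its average over `ω` is a probability measure on `[0,∞)`, the density of states measure,
whose distribution function is `N_N`; hence `N_N` is nondecreasing and right-continuous.

Filling every degree up to `2d` with loops makes the transition matrix `A` act as `1 - L/(2d)` on
the cluster, so the `n`-step return probability is the moment `∫ (1 - x/(2d))^n` of the spectral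
measure. Poisson weights of mean `2dt` sum these moments to `∫ e^{-tx}` (`returnProb_eq_integral`).
Averaging gives the Laplace transform over the closed half-line.

The open half-line omits the atom at `0`, of mass `N_N(0)`. Elements of `ker L` are constant on
clusters, so for a finite cluster the projection of `e_o` onto `ker L` is the normalised indicator
of `C_o`, and the atom is `1/|C_o|` (`localSpectralFn_zero_of_finite`). Subcriticality enters only
here.

Two points need care: the projection onto `ker (T - E)⁺` must be matched with the spectral measure
of `(-∞, E]` (`spectralMeasure_real_Iic`), and this measure must depend measurably on `ω`
(`measurable_spectralMeasure`). -/

noncomputable section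

namespace PercolationIDS

/-! ### Spectral measures and spectral projections of a bounded self-adjoint operator. -/

section SpectralMeasure

open Filter Topology CompactlySupported

variable {𝓗 : Type*} [NormedAddCommGroup 𝓗] [InnerProductSpace ℂ 𝓗] [CompleteSpace 𝓗]

/-- The positive functional `f ↦ Re ⟨v, f(T) v⟩` on the continuous functions on the spectrum. -/
def spectralFunctional (T : 𝓗 →L[ℂ] 𝓗) (hT : IsSelfAdjoint T) (v : 𝓗) :
    C_c(spectrum ℝ T, ℝ) →ₚ[ℝ] ℝ :=
  PositiveLinearMap.mk₀
    { toFun := fun f => (inner ℂ v (cfcHom (R := ℝ) hT f.toContinuousMap v)).re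
      map_add' := by
        intro f g
        have : (f + g).toContinuousMap = f.toContinuousMap + g.toContinuousMap := rfl
        rw [this, map_add, add_apply, inner_add_right, Complex.add_re]
      map_smul' := by
        intro c f
        have : (c • f).toContinuousMap = c • f.toContinuousMap := rfl
        rw [this, map_smul, smul_apply, inner_smul_right_eq_smul]
        simp }
    (by
      intro f hf
      have h : 0 ≤ cfcHom (R := ℝ) hT f.toContinuousMap := by
        rw [cfcHom_nonneg_iff]
        exact hf
      rw [ContinuousLinearMap.nonneg_iff_isPositive] at h
      have := h.re_inner_nonneg_right v
      simpa using this)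

/-- The spectral measure of the self-adjoint operator `T` at the vector `v`. -/
def spectralMeasure (T : 𝓗 →L[ℂ] 𝓗) (hT : IsSelfAdjoint T) (v : 𝓗) : Measure ℝ :=
  (RealRMK.rieszMeasure (spectralFunctional T hT v)).map Subtype.val

variable (T : 𝓗 →L[ℂ] 𝓗) (hT : IsSelfAdjoint T) (v : 𝓗)

instance : IsFiniteMeasure (spectralMeasure T hT v) := by
  unfold spectralMeasure
  infer_instance

theorem spectralMeasure_compl_spectrum : spectralMeasure T hT v (spectrum ℝ T)ᶜ = 0 := by
  have hm : MeasurableSet (spectrum ℝ T) := (spectrum.isClosed (𝕜 := ℝ) T).measurableSet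
  rw [spectralMeasure, Measure.map_apply measurable_subtype_coe hm.compl]
  simp

theorem ae_mem_spectrum : ∀ᵐ x ∂spectralMeasure T hT v, x ∈ spectrum ℝ T :=
  spectralMeasure_compl_spectrum T hT v

theorem integral_spectralMeasure {f : ℝ → ℝ} (hf : Continuous f) :
    ∫ x, f x ∂spectralMeasure T hT v = (inner ℂ v (cfc f T v)).re := by
  rw [spectralMeasure, integral_map measurable_subtype_coe.aemeasurable
    hf.aestronglyMeasurable]
  have := RealRMK.integral_rieszMeasure (spectralFunctional T hT v)
    (CompactlySupportedContinuousMap.continuousMapEquiv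
      ⟨fun x : spectrum ℝ T => f x, hf.comp continuous_subtype_val⟩)
  rw [cfc_apply f T hT hf.continuousOn]
  exact this

theorem integrable_spectralMeasure {f : ℝ → ℝ} (hf : Continuous f) :
    Integrable f (spectralMeasure T hT v) := by
  obtain ⟨C, hC⟩ := (spectrum.isCompact (𝕜 := ℝ) T).exists_bound_of_continuousOn hf.continuousOn
  exact Integrable.of_bound hf.aestronglyMeasurable C
    ((ae_mem_spectrum T hT v).mono fun x hx => hC x hx)

theorem isProbabilityMeasure_spectralMeasure (hv : ‖v‖ = 1) :
    IsProbabilityMeasure (spectralMeasure T hT v) := by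
  have h := integral_spectralMeasure T hT v (f := fun _ => 1) continuous_const
  rw [cfc_const_one ℝ T] at h
  rw [isProbabilityMeasure_iff_real]
  simpa [hv] using h

/-- Continuous approximations of the indicator function of `(-∞, E]`. -/
def iicApprox (E : ℝ) (n : ℕ) (x : ℝ) : ℝ := max 0 (1 - (n + 1) * max (x - E) 0)

theorem continuous_iicApprox (E : ℝ) (n : ℕ) : Continuous (iicApprox E n) := by
  unfold iicApprox
  fun_prop

theorem iicApprox_nonneg (E : ℝ) (n : ℕ) (x : ℝ) : 0 ≤ iicApprox E n x := le_max_left _ _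

theorem iicApprox_le_one (E : ℝ) (n : ℕ) (x : ℝ) : iicApprox E n x ≤ 1 := by
  have : 0 ≤ ((n : ℝ) + 1) * max (x - E) 0 := by positivity
  exact max_le zero_le_one (by linarith)

theorem tendsto_iicApprox (E x : ℝ) :
    Tendsto (fun n => iicApprox E n x) atTop (𝓝 ((Set.Iic E).indicator 1 x)) := by
  rcases le_or_gt x E with h | h
  · simp [iicApprox, h]
  · rw [Set.indicator_of_notMem (by simpa using h)]
    obtain ⟨N, hN⟩ := exists_nat_gt (1 / (x - E))
    have hx : 0 < x - E := sub_pos.2 h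
    refine tendsto_const_nhds.congr' ?_
    filter_upwards [eventually_ge_atTop N] with n hn
    have : 1 ≤ ((n : ℝ) + 1) * (x - E) := by
      rw [div_lt_iff₀ hx] at hN
      have : (N : ℝ) ≤ n := by exact_mod_cast hn
      nlinarith
    rw [iicApprox, max_eq_left hx.le, max_eq_left (by linarith)]

theorem tendsto_integral_iicApprox (ν : Measure ℝ) [IsFiniteMeasure ν] (E : ℝ) :
    Tendsto (fun n => ∫ x, iicApprox E n x ∂ν) atTop (𝓝 (ν.real (Set.Iic E))) := by
  rw [← integral_indicator_one measurableSet_Iic]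
  refine tendsto_integral_of_dominated_convergence (fun _ => 1)
    (fun n => (continuous_iicApprox E n).aestronglyMeasurable) (integrable_const _) ?_
    (.of_forall fun x => tendsto_iicApprox E x)
  intro n
  refine .of_forall fun x => ?_
  rw [Real.norm_of_nonneg (iicApprox_nonneg E n x)]
  exact iicApprox_le_one E n x

/-- Exhibits `1 - iicApprox` as a continuous multiple of `(x - E)⁺`, so that the functional calculus
of `iicApprox` is the identity on `ker (T - E)⁺`. The inner maximum with `1/(n+1)` keeps the inverse
continuous. -/
theorem iicApprox_eq (E : ℝ) (n : ℕ) (x : ℝ) : iicApprox E n x =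
    1 - (max ((n : ℝ) + 1)⁻¹ (max (x - E) 0))⁻¹ * max (x - E) 0 := by
  have hn : (0 : ℝ) < n + 1 := by positivity
  rw [iicApprox]
  set y := max (x - E) 0 with hy
  have hy0 : 0 ≤ y := le_max_right _ _
  rcases le_total (((n : ℝ) + 1)⁻¹) y with h | h
  · have hyp : 0 < y := (inv_pos.2 hn).trans_le h
    have : 1 ≤ ((n : ℝ) + 1) * y := by
      rw [inv_le_iff_one_le_mul₀ hn] at h
      linarith
    rw [max_eq_right h, inv_mul_cancel₀ hyp.ne', max_eq_left (by linarith), sub_self]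
  · have : ((n : ℝ) + 1) * y ≤ 1 := by
      calc ((n : ℝ) + 1) * y ≤ (n + 1) * ((n : ℝ) + 1)⁻¹ := by gcongr
        _ = 1 := mul_inv_cancel₀ hn.ne'
    rw [max_eq_left h, inv_inv, max_eq_right (by linarith)]

theorem cfc_iicApprox_apply_of_mem_ker (hT : IsSelfAdjoint T) (E : ℝ) (n : ℕ) {u : 𝓗}
    (hu : cfc (fun x : ℝ => max (x - E) 0) T u = 0) : cfc (iicApprox E n) T u = u := by
  have hg : Continuous fun x : ℝ => (max ((n : ℝ) + 1)⁻¹ (max (x - E) 0))⁻¹ := by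
    refine Continuous.inv₀ (by fun_prop) fun x => ?_
    exact (lt_max_of_lt_left (by positivity)).ne'
  have h1 := cfc_mul (fun x : ℝ => (max ((n : ℝ) + 1)⁻¹ (max (x - E) 0))⁻¹)
    (fun x : ℝ => max (x - E) 0) T hg.continuousOn (by fun_prop)
  have h2 := cfc_sub (fun _ : ℝ => (1 : ℝ))
    (fun x => (max ((n : ℝ) + 1)⁻¹ (max (x - E) 0))⁻¹ * max (x - E) 0) T (by fun_prop)
    (hg.mul (by fun_prop)).continuousOn
  rw [funext (iicApprox_eq E n), h2, cfc_const_one ℝ T, h1]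
  simp [hu]

/-- With `y = (x - E)⁺` and `z = (n+1)y`, the product is `z(1 - z)/(n+1)` or `0`. The approximants
therefore tend to zero on the range of `(T - E)⁺`. -/
theorem norm_cfc_iicApprox_mul_le (E : ℝ) (n : ℕ) :
    ‖cfc (iicApprox E n) T * cfc (fun x : ℝ => max (x - E) 0) T‖ ≤ ((n : ℝ) + 1)⁻¹ := by
  have hn : (0 : ℝ) < n + 1 := by positivity
  rw [← cfc_mul (iicApprox E n) (fun x : ℝ => max (x - E) 0) T
    (continuous_iicApprox E n).continuousOn (by fun_prop)]
  refine norm_cfc_le (by positivity) fun x _ => ?_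
  rw [norm_mul, Real.norm_of_nonneg (iicApprox_nonneg E n x),
    Real.norm_of_nonneg (le_max_right _ _), iicApprox, max_def]
  set y := max (x - E) 0 with hy
  have hy0 : 0 ≤ y := le_max_right _ _
  rw [← one_div, le_div_iff₀ hn]
  split_ifs with h
  · nlinarith
  · simp

theorem norm_cfc_iicApprox_le (E : ℝ) (n : ℕ) : ‖cfc (iicApprox E n) T‖ ≤ 1 := by
  refine norm_cfc_le zero_le_one fun x _ => ?_
  rw [Real.norm_of_nonneg (iicApprox_nonneg E n x)]
  exact iicApprox_le_one E n x

/-- For a self-adjoint operator the orthogonal complement of the kernel is the closure of the range.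
Decay on the range extends to the closure because the approximants are contractions. -/
theorem tendsto_cfc_iicApprox_of_mem_orthogonal (E : ℝ) {w : 𝓗}
    (hw : w ∈ (cfc (fun x : ℝ => max (x - E) 0) T : 𝓗 →L[ℂ] 𝓗).kerᗮ) :
    Tendsto (fun n => cfc (iicApprox E n) T w) atTop (𝓝 0) := by
  set B : 𝓗 →L[ℂ] 𝓗 := cfc (fun x : ℝ => max (x - E) 0) T with hB
  have hBsa : IsSelfAdjoint B := cfc_predicate _ T
  have hcl : w ∈ B.range.topologicalClosure := by
    rw [← Submodule.orthogonal_orthogonal_eq_closure, ContinuousLinearMap.orthogonal_range]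
    rwa [hBsa.adjoint_eq]
  have hcl' : w ∈ closure (Set.range B) := hcl
  rw [Metric.tendsto_atTop]
  intro ε hε
  obtain ⟨_, ⟨y, rfl⟩, hy⟩ := Metric.mem_closure_iff.1 hcl' (ε / 2) (by positivity)
  have hlim : Tendsto (fun n : ℕ => ((n : ℝ) + 1)⁻¹ * ‖y‖) atTop (𝓝 0) := by
    have := (tendsto_one_div_add_atTop_nhds_zero_nat (𝕜 := ℝ)).mul_const ‖y‖
    simpa using this
  obtain ⟨N, hN⟩ := (hlim.eventually (gt_mem_nhds (half_pos hε))).exists_forall_of_atTop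
  refine ⟨N, fun n hn => ?_⟩
  set Q := cfc (iicApprox E n) T with hQ
  have h1 : ‖Q (B y)‖ ≤ ((n : ℝ) + 1)⁻¹ * ‖y‖ :=
    (Q * B).le_of_opNorm_le (norm_cfc_iicApprox_mul_le T E n) y
  have h2 : ‖Q (w - B y)‖ ≤ 1 * ‖w - B y‖ := Q.le_of_opNorm_le (norm_cfc_iicApprox_le T E n) _
  rw [dist_eq_norm] at hy
  have h3 : Q w = Q (B y) + Q (w - B y) := by rw [map_sub]; abel
  rw [dist_zero_right, h3]
  have := norm_add_le (Q (B y)) (Q (w - B y))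
  have := hN n hn
  linarith

/-- Both sides are the limit of `⟨v, iicApprox(T) v⟩`: the approximants fix the component of `v` in
`ker (T - E)⁺` and send the orthogonal component to `0`. -/
theorem spectralMeasure_real_Iic (E : ℝ) : (spectralMeasure T hT v).real (Set.Iic E) =
    (inner ℂ v (spectralProjection T E v)).re := by
  refine tendsto_nhds_unique (tendsto_integral_iicApprox (spectralMeasure T hT v) E) ?_
  simp_rw [integral_spectralMeasure T hT v (continuous_iicApprox E _)]
  set K := (cfc (fun x : ℝ => max (x - E) 0) T : 𝓗 →L[ℂ] 𝓗).ker with hK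
  have hP : spectralProjection T E v = K.starProjection v := rfl
  have h1 : ∀ n, cfc (iicApprox E n) T v =
      K.starProjection v + cfc (iicApprox E n) T (v - K.starProjection v) := by
    intro n
    rw [map_sub, cfc_iicApprox_apply_of_mem_ker T hT E n (u := K.starProjection v)]
    · abel
    · exact K.starProjection_apply_mem v
  have h2 := tendsto_cfc_iicApprox_of_mem_orthogonal T E
    (w := v - K.starProjection v) (K.sub_starProjection_mem_orthogonal v)
  have h3 : Tendsto (fun n => cfc (iicApprox E n) T v) atTop (𝓝 (K.starProjection v)) := by
    simp_rw [h1]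
    simpa using h2.const_add (K.starProjection v)
  rw [hP]
  exact Complex.continuous_re.continuousAt.tendsto.comp (tendsto_const_nhds.inner h3)

theorem ae_abs_le_of_norm_le {M : ℝ} (hM : ‖T‖ ≤ M) :
    ∀ᵐ x ∂spectralMeasure T hT v, x ∈ Set.Icc (-M) M := by
  filter_upwards [ae_mem_spectrum T hT v] with x hx
  have h := spectrum.norm_le_norm_mul_of_mem hx
  have h1 : ‖(1 : 𝓗 →L[ℂ] 𝓗)‖ ≤ 1 := ContinuousLinearMap.norm_id_le
  rw [Set.mem_Icc, ← abs_le, ← Real.norm_eq_abs]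
  nlinarith [norm_nonneg T]

theorem integral_eval_spectralMeasure (q : Polynomial ℝ) :
    ∫ x, q.eval x ∂spectralMeasure T hT v =
      (inner ℂ v (Polynomial.aeval T q v)).re := by
  rw [integral_spectralMeasure T hT v q.continuous, cfc_polynomial q T hT]

theorem integral_one_sub_mul_pow_spectralMeasure (c : ℝ) (n : ℕ) :
    ∫ x, (1 - c * x) ^ n ∂spectralMeasure T hT v = (inner ℂ v (((1 - c • T) ^ n) v)).re := by
  have h := integral_eval_spectralMeasure T hT v ((1 - Polynomial.C c * Polynomial.X) ^ n)
  rw [map_pow, map_sub, map_one, map_mul, Polynomial.aeval_C, Polynomial.aeval_X,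
    ← Algebra.smul_def] at h
  simpa using h

theorem nonneg_of_sum_adjoint_mul {ι : Type*} [Fintype ι] {B : ι → 𝓗 →L[ℂ] 𝓗} {T : 𝓗 →L[ℂ] 𝓗}
    (h : ∑ j, ContinuousLinearMap.adjoint (B j) * B j = (2 : ℝ) • T) : 0 ≤ T := by
  have h1 : 0 ≤ (2 : ℝ) • T := by
    rw [← h]
    exact Finset.sum_nonneg fun j _ => star_mul_self_nonneg _
  have h2 := smul_nonneg (by norm_num : (0 : ℝ) ≤ 2⁻¹) h1
  rwa [smul_smul, inv_mul_cancel₀ two_ne_zero, one_smul] at h2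

/-- The positive part is the identity on a nonnegative spectrum, so `T⁺ = T`. -/
theorem spectralProjection_zero_of_nonneg {T : 𝓗 →L[ℂ] 𝓗} (hT : 0 ≤ T) :
    spectralProjection T 0 = T.ker.starProjection := by
  have h : cfc (fun x : ℝ => max (x - 0) 0) T = T := by
    conv_rhs => rw [← cfc_id' ℝ T (IsSelfAdjoint.of_nonneg hT)]
    refine cfc_congr fun x hx => ?_
    have := spectrum_nonneg_of_nonneg hT hx
    simpa using this
  unfold spectralProjection
  simp only [h]

theorem ae_nonneg_of_nonneg (h : 0 ≤ T) : ∀ᵐ x ∂spectralMeasure T hT v, 0 ≤ x :=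
  (ae_mem_spectrum T hT v).mono fun _ hx => spectrum_nonneg_of_nonneg h hx

/-! ### Measurable dependence of the spectral measure on a parameter. -/

section Measurability

variable {Ω : Type*} [MeasurableSpace Ω] {S : Ω → 𝓗 →L[ℂ] 𝓗} (hS : ∀ ω, IsSelfAdjoint (S ω))

/-- All the measures live on the common interval `[-M, M]`, so by Weierstrass the integral is a
limit of integrals of polynomials chosen independently of `ω`. Those are finite combinations of the
moments, which are measurable by `hmeas`. -/
theorem measurable_integral_spectralMeasure (hv : ‖v‖ = 1) {M : ℝ} (hM : ∀ ω, ‖S ω‖ ≤ M)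
    (hmeas : ∀ k : ℕ, Measurable fun ω => (inner ℂ v ((S ω ^ k) v)).re)
    {f : ℝ → ℝ} (hf : Continuous f) :
    Measurable fun ω => ∫ x, f x ∂spectralMeasure (S ω) (hS ω) v := by
  have hpoly : ∀ q : Polynomial ℝ,
      Measurable fun ω => ∫ x, q.eval x ∂spectralMeasure (S ω) (hS ω) v := by
    intro q
    have h : ∀ ω, ∫ x, q.eval x ∂spectralMeasure (S ω) (hS ω) v =
        ∑ k ∈ Finset.range (q.natDegree + 1), q.coeff k * (inner ℂ v ((S ω ^ k) v)).re := by
      intro ω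
      rw [integral_eval_spectralMeasure, Polynomial.aeval_eq_sum_range, sum_apply,
        inner_sum, Complex.re_sum]
      refine Finset.sum_congr rfl fun k _ => ?_
      rw [smul_apply, inner_smul_right_eq_smul]
      simp
    simp_rw [h]
    exact Finset.measurable_sum _ fun k _ => (hmeas k).const_mul _
  have happrox : ∀ n : ℕ, ∃ q : Polynomial ℝ, ∀ x ∈ Set.Icc (-M) M,
      |q.eval x - f x| < 1 / ((n : ℝ) + 1) := fun n =>
    exists_polynomial_near_of_continuousOn (-M) M f hf.continuousOn _ (by positivity)
  choose q hq using happrox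
  refine measurable_of_tendsto_metrizable (fun n => hpoly (q n)) ?_
  rw [tendsto_pi_nhds]
  intro ω
  have := isProbabilityMeasure_spectralMeasure (S ω) (hS ω) v hv
  rw [tendsto_iff_norm_sub_tendsto_zero]
  refine squeeze_zero (fun _ => norm_nonneg _) (fun n => ?_)
    (tendsto_one_div_add_atTop_nhds_zero_nat (𝕜 := ℝ))
  rw [← integral_sub (integrable_spectralMeasure _ _ _ (q n).continuous)
    (integrable_spectralMeasure _ _ _ hf)]
  refine (norm_integral_le_of_norm_le_const (C := 1 / ((n : ℝ) + 1)) ?_).trans (by simp)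
  filter_upwards [ae_abs_le_of_norm_le (S ω) (hS ω) v (hM ω)] with x hx
  exact (hq n x hx).le

theorem measurable_spectralMeasure (hv : ‖v‖ = 1) {M : ℝ} (hM : ∀ ω, ‖S ω‖ ≤ M)
    (hmeas : ∀ k : ℕ, Measurable fun ω => (inner ℂ v ((S ω ^ k) v)).re) :
    Measurable fun ω => spectralMeasure (S ω) (hS ω) v := by
  have := fun ω => isProbabilityMeasure_spectralMeasure (S ω) (hS ω) v hv
  refine .measure_of_isPiSystem_of_isProbabilityMeasure (borel_eq_generateFrom_Iic ℝ)
    isPiSystem_Iic ?_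
  rintro _ ⟨E, rfl⟩
  have h : Measurable fun ω => (spectralMeasure (S ω) (hS ω) v).real (Set.Iic E) :=
    measurable_of_tendsto_metrizable
      (fun n => measurable_integral_spectralMeasure v hS hv hM hmeas (continuous_iicApprox E n))
      (tendsto_pi_nhds.2 fun ω => tendsto_integral_iicApprox _ E)
  simpa [measureReal_def] using h.ennreal_ofReal

end Measurability

end SpectralMeasure

/-! ### The Laplacian as a sum of squares, its kernel, and the atom at zero. -/

section Laplacian

variable {d : ℕ} (ω : Config d)

/-- The sites from which the bond in direction `j` is open. -/
def openSites (j : Fin d × Bool) : Set (Fin d → ℤ) :=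
  {x | (openGraph ω).Adj x (x + unitStep j)}

/-- The opposite direction. -/
def oppositeStep (j : Fin d × Bool) : Fin d × Bool := (j.1, !j.2)

theorem oppositeStep_involutive : Function.Involutive (oppositeStep (d := d)) := by
  rintro ⟨i, b⟩
  simp [oppositeStep]

theorem unitStep_oppositeStep (j : Fin d × Bool) : unitStep (oppositeStep j) = -unitStep j := by
  obtain ⟨i, b⟩ := j
  cases b <;> simp [unitStep, oppositeStep, Pi.single_neg]

theorem add_unitStep_mem_openSites {x : Fin d → ℤ} {j : Fin d × Bool} :
    x + unitStep j ∈ openSites ω (oppositeStep j) ↔ x ∈ openSites ω j := by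
  simp only [openSites, Set.mem_ofPred_eq, unitStep_oppositeStep, add_neg_cancel_right]
  exact (openGraph ω).adj_comm _ _

theorem add_unitStep_oppositeStep_mem_openSites {x : Fin d → ℤ} {j : Fin d × Bool} :
    x + unitStep (oppositeStep j) ∈ openSites ω j ↔ x ∈ openSites ω (oppositeStep j) := by
  simpa [oppositeStep_involutive j] using
    add_unitStep_mem_openSites ω (x := x) (j := oppositeStep j)

/-- Restriction to the sites from which the bond in direction `j` is open. -/
def siteCut (j : Fin d × Bool) : EllTwo (Fin d → ℤ) →L[ℂ] EllTwo (Fin d → ℤ) :=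
  cutShift (Equiv.refl _) (openSites ω j)

/-- The shift along the open bonds in direction `j`. -/
def bondShift (j : Fin d × Bool) : EllTwo (Fin d → ℤ) →L[ℂ] EllTwo (Fin d → ℤ) :=
  cutShift (Equiv.addRight (unitStep j)) (openSites ω j)

open scoped Classical in
theorem siteCut_apply (j : Fin d × Bool) (f : EllTwo (Fin d → ℤ)) (x : Fin d → ℤ) :
    siteCut ω j f x = if x ∈ openSites ω j then f x else 0 := rfl

open scoped Classical in
theorem bondShift_apply (j : Fin d × Bool) (f : EllTwo (Fin d → ℤ)) (x : Fin d → ℤ) :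
    bondShift ω j f x = if x ∈ openSites ω j then f (x + unitStep j) else 0 := rfl

/-- The difference operator along the open bonds in direction `j`. -/
def bondDiff (j : Fin d × Bool) : EllTwo (Fin d → ℤ) →L[ℂ] EllTwo (Fin d → ℤ) :=
  siteCut ω j - bondShift ω j

theorem laplacian_eq_sum_bondDiff : laplacian ω = ∑ j, bondDiff ω j := rfl

open scoped Classical in
theorem bondDiff_apply (j : Fin d × Bool) (f : EllTwo (Fin d → ℤ)) (x : Fin d → ℤ) :
    bondDiff ω j f x = if x ∈ openSites ω j then f x - f (x + unitStep j) else 0 := by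
  rw [bondDiff, sub_apply, lp.coeFn_sub, Pi.sub_apply, siteCut_apply, bondShift_apply]
  split_ifs <;> simp

open scoped Classical in
theorem laplacian_apply_eq_sum (f : EllTwo (Fin d → ℤ)) (x : Fin d → ℤ) :
    laplacian ω f x = ∑ j, if x ∈ openSites ω j then f x - f (x + unitStep j) else 0 := by
  rw [laplacian_eq_sum_bondDiff, sum_apply, lp.coeFn_sum, Finset.sum_apply]
  exact Finset.sum_congr rfl fun j _ => bondDiff_apply ω j f x

theorem adjoint_siteCut (j : Fin d × Bool) :
    ContinuousLinearMap.adjoint (siteCut ω j) = siteCut ω j := by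
  classical
  symm
  rw [ContinuousLinearMap.eq_adjoint_iff]
  intro f g
  rw [lp.inner_eq_tsum, lp.inner_eq_tsum]
  congr 1
  funext x
  rw [siteCut_apply, siteCut_apply]
  by_cases h : x ∈ openSites ω j <;> simp [h]

theorem adjoint_bondShift (j : Fin d × Bool) :
    ContinuousLinearMap.adjoint (bondShift ω j) = bondShift ω (oppositeStep j) := by
  classical
  symm
  rw [ContinuousLinearMap.eq_adjoint_iff]
  intro f g
  rw [lp.inner_eq_tsum, lp.inner_eq_tsum, ← (Equiv.addRight (unitStep j)).tsum_eq
    (fun x => inner ℂ (bondShift ω (oppositeStep j) f x) (g x))]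
  congr 1
  funext x
  rw [bondShift_apply, bondShift_apply, Equiv.coe_addRight]
  have hx := add_unitStep_mem_openSites ω (x := x) (j := j)
  by_cases h : x ∈ openSites ω j
  · have h' := hx.2 h
    simp [h, h', unitStep_oppositeStep]
  · have h' := fun h'' => h (hx.1 h'')
    rw [if_neg h, if_neg h']
    simp

/-- At a site `x`, the left side collects the bond leaving `x` in direction `j` and the bond
arriving at `x` in direction `j`. The latter is the open bond leaving `x` in the opposite direction.
Summed over `j`, every direction occurs twice, whence the factor `2` in
`sum_adjoint_bondDiff_mul_bondDiff`. -/
theorem adjoint_bondDiff_mul_bondDiff (j : Fin d × Bool) :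
    ContinuousLinearMap.adjoint (bondDiff ω j) * bondDiff ω j =
      bondDiff ω j + bondDiff ω (oppositeStep j) := by
  classical
  have h1 : ContinuousLinearMap.adjoint (bondDiff ω j) =
      siteCut ω j - bondShift ω (oppositeStep j) := by
    rw [bondDiff, map_sub, adjoint_siteCut, adjoint_bondShift]
  rw [h1]
  ext f x
  have hx := add_unitStep_oppositeStep_mem_openSites ω (x := x) (j := j)
  rw [mul_apply_eq_comp, sub_apply, add_apply, lp.coeFn_sub, lp.coeFn_add,
    Pi.sub_apply, Pi.add_apply, siteCut_apply, bondShift_apply, bondDiff_apply, bondDiff_apply,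
    bondDiff_apply]
  simp only [hx]
  split_ifs <;> simp [unitStep_oppositeStep, sub_eq_add_neg]

theorem sum_adjoint_bondDiff_mul_bondDiff :
    ∑ j, ContinuousLinearMap.adjoint (bondDiff ω j) * bondDiff ω j = (2 : ℝ) • laplacian ω := by
  simp_rw [adjoint_bondDiff_mul_bondDiff]
  rw [Finset.sum_add_distrib, laplacian_eq_sum_bondDiff, two_smul]
  congr 1
  exact Equiv.sum_comp oppositeStep_involutive.toPerm (bondDiff ω)

theorem laplacian_nonneg : 0 ≤ laplacian ω :=
  nonneg_of_sum_adjoint_mul (sum_adjoint_bondDiff_mul_bondDiff ω)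

theorem norm_cutShift_le {V : Type*} (φ : V ≃ V) (S : Set V) : ‖cutShift φ S‖ ≤ 1 := by
  unfold cutShift
  exact LinearMap.mkContinuous_norm_le _ zero_le_one _

theorem norm_laplacian_le : ‖laplacian ω‖ ≤ 4 * d := by
  rw [laplacian_eq_sum_bondDiff]
  refine (norm_sum_le_of_le (f := bondDiff ω) Finset.univ (n := fun _ => 2) fun j _ => ?_).trans ?_
  · refine (norm_sub_le _ _).trans ?_
    have h1 := norm_cutShift_le (Equiv.refl _) (openSites ω j)
    have h2 := norm_cutShift_le (Equiv.addRight (unitStep j)) (openSites ω j)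
    rw [siteCut, bondShift]
    linarith
  · simp
    linarith

/-- The Dirichlet form is a sum of squares, `2⟨f, Lf⟩ = ∑ ‖B_j f‖²`, so every term vanishes with
`Lf`. -/
theorem bondDiff_eq_zero_of_laplacian_eq_zero {f : EllTwo (Fin d → ℤ)} (hf : laplacian ω f = 0)
    (j : Fin d × Bool) : bondDiff ω j f = 0 := by
  have h1 : ∑ j, ‖bondDiff ω j f‖ ^ 2 = 0 := by
    have h := congrArg (fun A : EllTwo (Fin d → ℤ) →L[ℂ] EllTwo (Fin d → ℤ) =>
      (inner ℂ f (A f)).re) (sum_adjoint_bondDiff_mul_bondDiff ω)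
    simp only [sum_apply, inner_sum, Complex.re_sum, mul_apply_eq_comp,
      ContinuousLinearMap.adjoint_inner_right, smul_apply, hf, smul_zero, inner_zero_right,
      Complex.zero_re] at h
    rw [← h]
    refine Finset.sum_congr rfl fun j _ => ?_
    rw [inner_self_eq_norm_sq_to_K]
    norm_cast
  have h2 := (Finset.sum_eq_zero_iff_of_nonneg fun j _ => by positivity).1 h1 j (Finset.mem_univ j)
  simpa using h2

theorem apply_eq_of_adj_of_laplacian_eq_zero {f : EllTwo (Fin d → ℤ)} (hf : laplacian ω f = 0)
    {x y : Fin d → ℤ} (h : (openGraph ω).Adj x y) : f x = f y := by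
  classical
  obtain ⟨j, rfl⟩ := (lattice_adj_iff x y).1 (openGraph_le ω h)
  have h1 := bondDiff_apply ω j f x
  rw [bondDiff_eq_zero_of_laplacian_eq_zero ω hf, if_pos (show x ∈ openSites ω j from h)] at h1
  exact (sub_eq_zero.1 h1.symm)

theorem apply_eq_of_reachable_of_laplacian_eq_zero {f : EllTwo (Fin d → ℤ)}
    (hf : laplacian ω f = 0) {x y : Fin d → ℤ} (h : (openGraph ω).Reachable x y) :
    f x = f y := by
  obtain ⟨w⟩ := h
  induction w with
  | nil => rfl
  | cons h _ ih => exact (apply_eq_of_adj_of_laplacian_eq_zero ω hf h).trans ih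

theorem mem_originCluster_iff {x : Fin d → ℤ} :
    x ∈ (originCluster ω).supp ↔ (openGraph ω).Reachable x 0 := by
  rw [SimpleGraph.ConnectedComponent.mem_supp_iff, originCluster, SimpleGraph.ConnectedComponent.eq]

theorem norm_originVector : ‖originVector d‖ = 1 := by
  rw [originVector, lp.norm_single (by norm_num)]
  simp

theorem inner_originVector (f : EllTwo (Fin d → ℤ)) : inner ℂ (originVector d) f = f 0 := by
  rw [originVector, lp.inner_single_left]
  simp

theorem localSpectralFn_zero_of_finite (h : (originCluster ω).supp.Finite) :
    localSpectralFn 0 ω = 1 / ((originCluster ω).supp.ncard : ℝ) := by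
  classical
  set S := (originCluster ω).supp with hS
  set m : ℂ := (S.ncard : ℂ) with hm
  have h0 : (0 : Fin d → ℤ) ∈ S := (mem_originCluster_iff ω).2 (.refl _)
  have hm0 : m ≠ 0 := by
    rw [hm, Nat.cast_ne_zero]
    exact (Set.ncard_pos h).2 ⟨0, h0⟩ |>.ne'
  -- The projection of `e_o` onto the kernel: it averages over the cluster, and finiteness of the
  -- cluster puts it in `ℓ²`.
  let w : EllTwo (Fin d → ℤ) := ∑ x ∈ h.toFinset, lp.single 2 x m⁻¹
  have hw : ∀ x, w x = if x ∈ S then m⁻¹ else 0 := by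
    intro x
    simp only [w, lp.coeFn_sum, Finset.sum_apply, lp.single_apply, Pi.single_apply]
    rw [Finset.sum_ite_eq]
    simp
  have hker : laplacian ω w = 0 := by
    apply lp.ext
    funext x
    rw [laplacian_apply_eq_sum]
    refine Finset.sum_eq_zero fun j _ => ?_
    split_ifs with hj
    · have : x ∈ S ↔ x + unitStep j ∈ S := by
        rw [hS, mem_originCluster_iff, mem_originCluster_iff]
        exact ⟨fun hx => hj.reachable.symm.trans hx, fun hx => hj.reachable.trans hx⟩
      rw [hw, hw]
      simp [this]
    · rfl
  have hproj : (laplacian ω).ker.starProjection (originVector d) = w := by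
    -- A kernel element `f` equals `f 0` on the whole cluster, so pairing it with `w` gives `f 0`,
    -- as does pairing it with `e_o`.
    refine Submodule.eq_starProjection_of_mem_of_inner_eq_zero hker fun f hf => ?_
    have hf' : laplacian ω f = 0 := hf
    rw [inner_sub_left, inner_originVector]
    have : inner ℂ w f = ∑ x ∈ h.toFinset, m⁻¹ * f 0 := by
      rw [sum_inner]
      refine Finset.sum_congr rfl fun x hx => ?_
      rw [lp.inner_single_left, apply_eq_of_reachable_of_laplacian_eq_zero ω hf'
        ((mem_originCluster_iff ω).1 ((Set.Finite.mem_toFinset h).1 hx))]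
      simp [hm, mul_comm]
    rw [this, Finset.sum_const, ← Set.ncard_eq_toFinset_card S h, nsmul_eq_mul, ← hm,
      mul_inv_cancel_left₀ hm0, sub_self]
  rw [localSpectralFn, spectralProjection_zero_of_nonneg (laplacian_nonneg ω), hproj, inner_originVector, hw, if_pos h0,
    hm, one_div, ← Complex.ofReal_natCast, ← Complex.ofReal_inv, Complex.ofReal_re]

end Laplacian

/-! ### Measurability of the spectral measure in the percolation configuration. -/

section Measurability

variable {d : ℕ}

theorem openGraph_adj_iff (ω : Config d) {x y : Fin d → ℤ} (h : s(x, y) ∈ (lattice d).edgeSet) :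
    (openGraph ω).Adj x y ↔ ω ⟨s(x, y), h⟩ = true := by
  rw [openGraph, SimpleGraph.fromEdgeSet_adj]
  constructor
  · rintro ⟨⟨_, h'⟩, _⟩
    exact h'
  · exact fun h' => ⟨⟨h, h'⟩, (SimpleGraph.mem_edgeSet _).1 h |>.ne⟩

theorem measurableSet_mem_openSites (x : Fin d → ℤ) (j : Fin d × Bool) :
    MeasurableSet {ω : Config d | x ∈ openSites ω j} := by
  have h : s(x, x + unitStep j) ∈ (lattice d).edgeSet :=
    (SimpleGraph.mem_edgeSet _).2 ((lattice_adj_iff _ _).2 ⟨j, rfl⟩)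
  have heq : {ω : Config d | x ∈ openSites ω j} =
      (fun ω : Config d => ω ⟨s(x, x + unitStep j), h⟩) ⁻¹' {true} := by
    ext ω
    exact openGraph_adj_iff ω h
  rw [heq]
  exact measurable_pi_apply _ (measurableSet_singleton _)

theorem measurable_laplacian_pow_apply (k : ℕ) (f : EllTwo (Fin d → ℤ)) (x : Fin d → ℤ) :
    Measurable fun ω : Config d => (laplacian ω ^ k) f x := by
  classical
  induction k generalizing x with
  | zero => simp
  | succ k ih =>
    simp_rw [pow_succ', mul_apply_eq_comp, laplacian_apply_eq_sum]
    exact Finset.measurable_sum _ fun j _ =>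
      ((ih x).sub (ih _)).ite (measurableSet_mem_openSites x j) measurable_const

/-- The spectral measure of the Laplacian at the origin. -/
def originSpectralMeasure (ω : Config d) : Measure ℝ :=
  spectralMeasure (laplacian ω) (laplacian_isSelfAdjoint ω) (originVector d)

instance (ω : Config d) : IsProbabilityMeasure (originSpectralMeasure ω) :=
  isProbabilityMeasure_spectralMeasure _ _ _ norm_originVector

theorem measurable_originSpectralMeasure :
    Measurable (originSpectralMeasure (d := d)) := by
  refine measurable_spectralMeasure (originVector d) laplacian_isSelfAdjoint norm_originVector
    norm_laplacian_le fun k => ?_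
  simp_rw [inner_originVector]
  exact Complex.measurable_re.comp (measurable_laplacian_pow_apply k _ 0)

theorem localSpectralFn_eq_originSpectralMeasure (E : ℝ) (ω : Config d) :
    localSpectralFn E ω = (originSpectralMeasure ω).real (Set.Iic E) :=
  (spectralMeasure_real_Iic _ _ _ E).symm

theorem ae_mem_Icc_originSpectralMeasure (ω : Config d) :
    ∀ᵐ x ∂originSpectralMeasure ω, x ∈ Set.Icc 0 (4 * d : ℝ) := by
  filter_upwards [ae_nonneg_of_nonneg _ (laplacian_isSelfAdjoint ω) (originVector d)
    (laplacian_nonneg ω), ae_abs_le_of_norm_le _ (laplacian_isSelfAdjoint ω) (originVector d) (norm_laplacian_le ω)]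
    with x hx hx'
  exact ⟨hx, hx'.2⟩

end Measurability

/-! ### The regularised walk as the operator `1 - L/(2d)`, and its return probability. -/

section Walk

variable {d : ℕ} (ω : Config d) (C : (openGraph ω).ConnectedComponent)

theorem add_unitStep_mem_supp {x : Fin d → ℤ} (hx : x ∈ C.supp) {j : Fin d × Bool}
    (hj : x ∈ openSites ω j) : x + unitStep j ∈ C.supp :=
  (C.mem_supp_congr_adj hj).1 hx

theorem toSimpleGraph_adj_iff (x z : C) : C.toSimpleGraph.Adj x z ↔
    ∃ j, x.1 ∈ openSites ω j ∧ z.1 = x.1 + unitStep j := by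
  have h : C.toSimpleGraph.Adj x z ↔ (openGraph ω).Adj x z := Iff.rfl
  rw [h]
  constructor
  · intro h
    obtain ⟨j, hj⟩ := (lattice_adj_iff _ _).1 (openGraph_le ω h)
    exact ⟨j, by rwa [hj] at h, hj⟩
  · rintro ⟨j, hj, hz⟩
    rw [hz]
    exact hj

open scoped Classical in
theorem ncard_neighborSet_toSimpleGraph (x : C) : (C.toSimpleGraph.neighborSet x).ncard =
    (Finset.univ.filter fun j => x.1 ∈ openSites ω j).card := by
  have h : Subtype.val '' C.toSimpleGraph.neighborSet x =
      ((Finset.univ.filter fun j => x.1 ∈ openSites ω j).image fun j => x.1 + unitStep j :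
        Finset (Fin d → ℤ)) := by
    ext y
    simp only [Set.mem_image, SimpleGraph.mem_neighborSet, toSimpleGraph_adj_iff,
      Finset.coe_image, Finset.coe_filter, Finset.mem_univ, true_and, Set.mem_ofPred_eq]
    constructor
    · rintro ⟨z, ⟨j, hj, hz⟩, rfl⟩
      exact ⟨j, hj, hz.symm⟩
    · rintro ⟨j, hj, rfl⟩
      exact ⟨⟨_, add_unitStep_mem_supp ω C x.2 hj⟩, ⟨j, hj, rfl⟩, rfl⟩
  rw [← Set.ncard_image_of_injective _ Subtype.val_injective, h, Set.ncard_coe_finset,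
    Finset.card_image_of_injective _ fun a b hab => unitStep_injective (add_left_cancel hab)]

-- Neighbours in the cluster correspond bijectively to open directions, so a sum over a possibly
-- infinite cluster becomes a finite sum over directions.
open scoped Classical in
theorem hasSum_adj_mul (φ : (Fin d → ℤ) → ℝ) (x : C) :
    HasSum (fun z : C => (if C.toSimpleGraph.Adj x z then 1 else 0) * φ z)
      (∑ j, if x.1 ∈ openSites ω j then φ (x.1 + unitStep j) else 0) := by
  have h : ∀ j, HasSum (fun z : C => if x.1 ∈ openSites ω j ∧ z.1 = x.1 + unitStep j then
      φ z else 0) (if x.1 ∈ openSites ω j then φ (x.1 + unitStep j) else 0) := by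
    intro j
    by_cases hj : x.1 ∈ openSites ω j
    · rw [if_pos hj]
      convert hasSum_ite_eq (⟨_, add_unitStep_mem_supp ω C x.2 hj⟩ : C) (φ (x.1 + unitStep j))
        using 2 with z
      by_cases hz : z.1 = x.1 + unitStep j
      · simp [hj, hz, Subtype.ext_iff]
      · simp [hz, Subtype.ext_iff]
    · simp [hj, hasSum_zero]
  convert hasSum_sum (s := Finset.univ) fun j _ => h j using 2 with z
  by_cases hz : C.toSimpleGraph.Adj x z
  · obtain ⟨j, hj, hzj⟩ := (toSimpleGraph_adj_iff ω C x z).1 hz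
    rw [if_pos hz, one_mul, Finset.sum_eq_single j]
    · rw [if_pos ⟨hj, hzj⟩]
    · rintro k - hk
      refine if_neg fun ⟨_, hzk⟩ => hk (unitStep_injective (add_left_cancel (hzk.symm.trans hzj)))
    · simp
  · rw [if_neg hz, zero_mul]
    refine (Finset.sum_eq_zero fun j _ => if_neg fun hj => hz ?_).symm
    exact (toSimpleGraph_adj_iff ω C x z).2 ⟨j, hj⟩

open scoped Classical in
theorem tsum_rrwTransition_mul (hd : 1 ≤ d) (φ : (Fin d → ℤ) → ℝ) (x : C) :
    ∑' z : C, rrwTransition C.toSimpleGraph (2 * d) x z * φ z =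
      φ x - (2 * d : ℝ)⁻¹ *
        ∑ j, if x.1 ∈ openSites ω j then φ x - φ (x.1 + unitStep j) else 0 := by
  have hd' : (d : ℝ) ≠ 0 := by positivity
  -- The number of loops at `x`; it cancels the degree term, leaving `φ x` with coefficient `1`
  -- outside the Laplacian.
  set c : ℝ := (2 * d : ℕ) - ((C.toSimpleGraph.neighborSet x).ncard : ℝ) with hc
  have h := ((hasSum_adj_mul ω C φ x).add (hasSum_ite_eq x (c * φ x))).mul_left (2 * d : ℝ)⁻¹
  have heq : ∀ z : C, rrwTransition C.toSimpleGraph (2 * d) x z * φ z = (2 * d : ℝ)⁻¹ *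
      ((if C.toSimpleGraph.Adj x z then 1 else 0) * φ z + if z = x then c * φ x else 0) := by
    intro z
    rw [rrwTransition, regularisedAdj]
    by_cases hz : x = z
    · subst hz
      simp [hc]
      ring
    · rw [if_neg hz, if_neg (Ne.symm hz)]
      push_cast
      ring
  simp_rw [heq]
  rw [h.tsum_eq, hc, ncard_neighborSet_toSimpleGraph]
  have hsplit : (∑ j, if x.1 ∈ openSites ω j then φ x - φ (x.1 + unitStep j) else 0) =
      (Finset.univ.filter fun j => x.1 ∈ openSites ω j).card * φ x -
        ∑ j, if x.1 ∈ openSites ω j then φ (x.1 + unitStep j) else 0 := by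
    rw [← Finset.sum_filter, ← Finset.sum_filter, Finset.sum_sub_distrib]
    simp
  rw [hsplit]
  push_cast
  field_simp
  ring

/-- The one-step operator `1 - L / (2d)` of the regularised random walk on `ℓ²(ℤ^d)`. -/
def walkOperator : EllTwo (Fin d → ℤ) →L[ℂ] EllTwo (Fin d → ℤ) :=
  1 - ((2 * d : ℝ)⁻¹ : ℝ) • laplacian ω

open scoped Classical in
theorem re_walkOperator_apply (f : EllTwo (Fin d → ℤ)) (x : Fin d → ℤ) :
    (walkOperator ω f x).re = (f x).re - (2 * d : ℝ)⁻¹ *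
      ∑ j, if x ∈ openSites ω j then (f x).re - (f (x + unitStep j)).re else 0 := by
  have h : walkOperator ω f x = f x - ((2 * d : ℝ)⁻¹ : ℝ) • laplacian ω f x := rfl
  rw [h, Complex.sub_re, Complex.smul_re, laplacian_apply_eq_sum, Complex.re_sum, smul_eq_mul]
  congr 2
  refine Finset.sum_congr rfl fun j _ => ?_
  split_ifs <;> simp

/-- Open bonds from a site of `C` stay in `C`, so the recursion on `C` and the operator on all of
`ℤ^d` agree at sites of `C`. No finiteness of `C` is involved. -/
theorem rrwStep_eq_re_walkOperator_pow (hd : 1 ≤ d) (n : ℕ) (x y : C) :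
    rrwStep C.toSimpleGraph (2 * d) n x y =
      ((walkOperator ω ^ n) (lp.single 2 y.1 (1 : ℂ)) x.1).re := by
  classical
  induction n generalizing x with
  | zero =>
    rw [rrwStep, pow_zero, one_apply_eq_self, lp.single_apply]
    by_cases h : x = y
    · simp [h]
    · have : x.1 ≠ y.1 := fun h' => h (Subtype.ext h')
      simp [h, this]
  | succ n ih =>
    rw [rrwStep, pow_succ', mul_apply_eq_comp, re_walkOperator_apply]
    simp_rw [ih]
    exact tsum_rrwTransition_mul ω C hd
      (fun z => ((walkOperator ω ^ n) (lp.single 2 y.1 (1 : ℂ)) z).re) x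

theorem rrwStep_origin_eq_integral (hd : 1 ≤ d) (n : ℕ) :
    rrwStep (originCluster ω).toSimpleGraph (2 * d) n (originInCluster ω) (originInCluster ω) =
      ∫ x, (1 - (2 * d : ℝ)⁻¹ * x) ^ n ∂originSpectralMeasure ω := by
  rw [originSpectralMeasure, integral_one_sub_mul_pow_spectralMeasure, inner_originVector]
  exact rrwStep_eq_re_walkOperator_pow ω (originCluster ω) hd n (originInCluster ω)
    (originInCluster ω)

theorem returnProb_eq_integral (hd : 1 ≤ d) {t : ℝ} (ht : 0 ≤ t) :
    returnProb (2 * d * t) ω = ∫ x, Real.exp (-t * x) ∂originSpectralMeasure ω := by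
  have hd' : (d : ℝ) ≠ 0 := by positivity
  set s : ℝ := 2 * d * t with hs
  have hs0 : 0 ≤ s := by positivity
  set u : ℝ → ℝ := fun x => 1 - (2 * d : ℝ)⁻¹ * x with hu
  -- The exponential series is integrated termwise; the Poisson weights themselves dominate, since
  -- `|u| ≤ 1` on the support.
  have h := hasSum_integral_of_dominated_convergence (μ := originSpectralMeasure ω)
    (F := fun (n : ℕ) x => Real.exp (-s) * (s ^ n / n.factorial * u x ^ n))
    (f := fun x => Real.exp (-t * x))
    (fun n _ => Real.exp (-s) * (s ^ n / n.factorial)) (fun n => by fun_prop) ?_ ?_ ?_ ?_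
  · rw [returnProb, rrwHeat, ← h.tsum_eq]
    congr 1
    funext n
    rw [rrwStep_origin_eq_integral ω hd, ← integral_const_mul]
    congr 1
    funext x
    rw [hu]
    ring
  · intro n
    filter_upwards [ae_mem_Icc_originSpectralMeasure ω] with x hx
    -- The spectrum lies in `[0, 4d]`, which `u` maps into `[-1, 1]`.
    have h1 : |u x| ≤ 1 := by
      have h2 : (2 * d : ℝ)⁻¹ * x ≤ (2 * d : ℝ)⁻¹ * (4 * d) := by gcongr; exact hx.2
      have h3 : (2 * d : ℝ)⁻¹ * (4 * d) = 2 := by field_simp; norm_num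
      have h4 : 0 ≤ (2 * d : ℝ)⁻¹ * x := mul_nonneg (by positivity) hx.1
      rw [abs_le]
      constructor <;> simp only [hu] <;> linarith
    rw [norm_mul, norm_mul, norm_pow, Real.norm_of_nonneg (Real.exp_pos _).le,
      Real.norm_of_nonneg (by positivity)]
    have := pow_le_one₀ (n := n) (abs_nonneg (u x)) h1
    calc _ ≤ Real.exp (-s) * (s ^ n / n.factorial * 1) := by
          gcongr
          exact this
      _ = _ := by rw [mul_one]
  · exact .of_forall fun x => (Real.summable_pow_div_factorial s).mul_left _
  · exact integrable_const _
  · refine .of_forall fun x => ?_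
    have h1 : HasSum (fun n : ℕ => (s * u x) ^ n / n.factorial) (Real.exp (s * u x)) := by
      rw [Real.exp_eq_exp_ℝ]
      exact NormedSpace.expSeries_div_hasSum_exp _
    have h2 : Real.exp (-t * x) = Real.exp (-s) * Real.exp (s * u x) := by
      rw [← Real.exp_add]
      congr 1
      simp only [hu, hs]
      field_simp
      ring
    rw [h2]
    have h3 := h1.mul_left (Real.exp (-s))
    simp_rw [mul_pow, mul_div_right_comm] at h3
    exact h3

end Walk

/-! ### Averaging over the percolation: the density of states measure. -/

section Averaging

variable {d : ℕ} (p : unitInterval)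

instance : IsProbabilityMeasure (percMeasure d p) := by
  unfold percMeasure
  infer_instance

/-- The spectral measure of the Laplacian at the origin as a Markov kernel. -/
def originSpectralKernel (d : ℕ) : Kernel (Config d) ℝ :=
  ⟨originSpectralMeasure, measurable_originSpectralMeasure⟩

instance : IsMarkovKernel (originSpectralKernel d) :=
  ⟨fun ω => inferInstanceAs (IsProbabilityMeasure (originSpectralMeasure ω))⟩

/-- The density of states measure. -/
def densityOfStates (d : ℕ) (p : unitInterval) : Measure ℝ :=
  (percMeasure d p).bind (originSpectralKernel d)

instance : IsProbabilityMeasure (densityOfStates d p) := by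
  unfold densityOfStates
  infer_instance

theorem integrable_localSpectralFn (E : ℝ) :
    Integrable (localSpectralFn (d := d) E) (percMeasure d p) := by
  rw [show localSpectralFn (d := d) E = fun ω => (originSpectralKernel d ω).real (Set.Iic E) from
    funext fun ω => localSpectralFn_eq_originSpectralMeasure E ω]
  refine Integrable.of_bound ((originSpectralKernel d).measurable_coe
    measurableSet_Iic).ennreal_toReal.aestronglyMeasurable 1 (.of_forall fun ω => ?_)
  rw [Real.norm_of_nonneg measureReal_nonneg]
  exact measureReal_le_one

theorem densityOfStates_real_Iic (E : ℝ) :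
    (densityOfStates d p).real (Set.Iic E) = ids d p E := by
  rw [measureReal_def, densityOfStates, Measure.bind_apply measurableSet_Iic
    (originSpectralKernel d).aemeasurable, ids]
  simp_rw [localSpectralFn_eq_originSpectralMeasure, measureReal_def]
  exact (integral_toReal ((originSpectralKernel d).measurable_coe measurableSet_Iic).aemeasurable
    (.of_forall fun ω => measure_lt_top _ _)).symm

theorem cdf_densityOfStates (E : ℝ) : cdf (densityOfStates d p) E = ids d p E := by
  rw [cdf_eq_real, densityOfStates_real_Iic]

theorem ae_nonneg_densityOfStates : ∀ᵐ x ∂densityOfStates d p, 0 ≤ x := by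
  have hm : MeasurableSet {x : ℝ | 0 ≤ x} := measurableSet_Ici
  rw [densityOfStates, Measure.ae_comp_iff hm]
  exact .of_forall fun ω => (ae_mem_Icc_originSpectralMeasure ω).mono fun x hx => hx.1

theorem integrable_exp_densityOfStates {t : ℝ} (ht : 0 ≤ t) :
    Integrable (fun x => Real.exp (-t * x)) (densityOfStates d p) := by
  refine Integrable.of_bound (by fun_prop) 1 ?_
  filter_upwards [ae_nonneg_densityOfStates p] with x hx
  rw [Real.norm_of_nonneg (Real.exp_pos _).le, Real.exp_le_one_iff]
  nlinarith

theorem integrable_returnProb (hd : 1 ≤ d) {t : ℝ} (ht : 0 ≤ t) :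
    Integrable (returnProb (d := d) (2 * d * t)) (percMeasure d p) := by
  rw [show returnProb (d := d) (2 * d * t) = _ from funext fun ω => returnProb_eq_integral ω hd ht]
  have h := integrable_exp_densityOfStates (d := d) p ht
  -- Viewing the averaged measure as a composition with a constant kernel makes Fubini for kernels
  -- applicable.
  rw [densityOfStates, Measure.comp_eq_comp_const_apply] at h
  exact h.integral_comp

theorem integral_exp_densityOfStates (hd : 1 ≤ d) {t : ℝ} (ht : 0 ≤ t) :
    ∫ x, Real.exp (-t * x) ∂densityOfStates d p =
      ∫ ω, returnProb (2 * d * t) ω ∂percMeasure d p := by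
  simp_rw [returnProb_eq_integral _ hd ht]
  have h := integrable_exp_densityOfStates (d := d) p ht
  rw [densityOfStates, Measure.comp_eq_comp_const_apply] at h ⊢
  exact Kernel.integral_comp h

/-- A value below the infimum is outside the defining set, so an infinite cluster has probability
zero; monotonicity in `p` is not needed. -/
theorem ae_finite_originCluster (hp : p < criticalProbability d) :
    ∀ᵐ ω ∂percMeasure d p, (originCluster ω).supp.Finite := by
  have h : p ∉ {q | 0 < percMeasure d q {ω | (originCluster ω).supp.Infinite}} :=
    fun h => hp.not_ge (sInf_le h)
  rw [Set.mem_ofPred_eq, not_lt, nonpos_iff_eq_zero] at h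
  exact h

/-- On `(-∞, 0]` the measure charges only the point `0`, where the exponential is `1`; the removed
part is thus the mass `N_N(0)`. -/
theorem integral_exp_Ioi_densityOfStates {t : ℝ} (ht : 0 ≤ t) :
    ∫ x in Set.Ioi (0 : ℝ), Real.exp (-t * x) ∂densityOfStates d p =
      ∫ x, Real.exp (-t * x) ∂densityOfStates d p - ids d p 0 := by
  have h1 := integral_add_compl measurableSet_Iic (s := Set.Iic (0 : ℝ))
    (integrable_exp_densityOfStates (d := d) p ht)
  have h2 : ∫ x in Set.Iic (0 : ℝ), Real.exp (-t * x) ∂densityOfStates d p = ids d p 0 := by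
    rw [← densityOfStates_real_Iic, ← setIntegral_one_eq_measureReal]
    refine setIntegral_congr_ae measurableSet_Iic ?_
    filter_upwards [ae_nonneg_densityOfStates p] with x hx hx'
    simp [le_antisymm hx' hx]
  rw [Set.compl_Iic] at h1
  linarith

end Averaging

end PercolationIDS

end

/-! ### The Laplace transform of the integrated density of states. -/

open PercolationIDS in
theorem mainTheorem9 (d : ℕ) (hd : 1 ≤ d) (p : unitInterval) (hp : p < criticalProbability d) :
    (∀ᵐ ω ∂percMeasure d p, (originCluster ω).supp.Finite) ∧
    (∀ E : ℝ, MeasureTheory.Integrable (localSpectralFn (d := d) E) (percMeasure d p)) ∧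
    MeasureTheory.Integrable
      (fun ω : Config d => 1 / ((originCluster ω).supp.ncard : ℝ)) (percMeasure d p) ∧
    ∃ N : StieltjesFunction ℝ, (∀ E : ℝ, N E = ids d p E) ∧
      ∀ t : ℝ, 0 ≤ t →
        MeasureTheory.Integrable (returnProb (d := d) (2 * d * t)) (percMeasure d p) ∧
        MeasureTheory.IntegrableOn (fun E : ℝ => Real.exp (-t * E)) (Set.Ioi 0) N.measure ∧
        ∫ E in Set.Ioi (0 : ℝ), Real.exp (-t * E) ∂N.measure =
          (∫ ω, returnProb (d := d) (2 * d * t) ω ∂percMeasure d p) -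
            ∫ ω : Config d, 1 / ((originCluster ω).supp.ncard : ℝ) ∂percMeasure d p := by
  have hfin := ae_finite_originCluster p hp
  have hae : localSpectralFn (d := d) 0 =ᵐ[percMeasure d p]
      fun ω : Config d => 1 / ((originCluster ω).supp.ncard : ℝ) :=
    hfin.mono fun ω h => localSpectralFn_zero_of_finite ω h
  refine ⟨hfin, integrable_localSpectralFn p, (integrable_localSpectralFn p 0).congr hae,
    -- As a `cdf`, `N` carries monotonicity and right-continuity, and `measure_cdf` turns its
    -- Stieltjes measure back into the density of states measure.
    cdf (densityOfStates d p), cdf_densityOfStates p, fun t ht =>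
      ⟨integrable_returnProb p hd ht, ?_, ?_⟩⟩
  · rw [measure_cdf]
    exact (integrable_exp_densityOfStates p ht).integrableOn
  · rw [measure_cdf, integral_exp_Ioi_densityOfStates p ht, integral_exp_densityOfStates p hd ht,
      ← integral_congr_ae hae, ids]
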